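/- Let $X$ be a real Banach space with topological dual $X^*$ and bidual $X^{**}$, and identify $X$ with its canonical image in $X^{**}$. Let $T\subset X\times X^*$ be maximal monotone, that is, $\langle x-y,x^*-y^*\rangle\ge 0$ for all $(x,x^*),(y,y^*)\in T$ and $T$ is maximal, with respect to inclusion, among the subsets of $X\times X^*$ with this property. Write $\pi(x,x^*)=\langle x,x^*\rangle$ on $X\times X^*$ and $\pi_*(x^*,x^{**})=\langle x^*,x^{**}\rangle$ on $X^*\times X^{**}$. The Fitzpatrick family $\mathcal F_T$ is the set of all convex functions $h:X\times X^*\to[-\infty,\infty]$, lower semicontinuous for the norm topology, such that $h\ge\pi$ on $X\times X^*$ and $h=\pi$ on $T$. For $h:X\times X^*\to[-\infty,\infty]$, the conjugate $h^*:X^*\times X^{**}\to[-\infty,\infty]$ is $$h^*(x^*,x^{**})=\sup_{(y,y^*)\in X\times X^*}\ \langle y,x^*\rangle+\langle y^*,x^{**}\rangle-h(y,y^*),$$ and, for $(x_0,x_0^*)\in X\times X^*$, $$h_{(x_0,x_0^*)}(x,x^*)=h(x+x_0,x^*+x_0^*)-\big[\langle x,x_0^*\rangle+\langle x_0,x^*\rangle+\langle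 x_0,x_0^*\rangle\big].$$ The maximal monotone operator $T$ is called type NI if $$\inf_{(y,y^*)\in T}\langle y^*-x^*,\,y-x^{**}\rangle\le 0\qquad\text{for all }(x^*,x^{**})\in X^*\times X^{**}.$$ Then the following conditions are equivalent: 1. $T$ is type NI; 2. there exists $h\in\mathcal F_T$ such that $h\ge\pi$ and $h^*\ge\pi_*$; 3. for all $h\in\mathcal F_T$, $h\ge\pi$ and $h^*\ge\pi_*$; 4. there exists $h\in\mathcal F_T$ such that $$\inf_{(x,x^*)\in X\times X^*}\Big[h_{(x_0,x_0^*)}(x,x^*)+\tfrac12\|x\|^2+\tfrac12\|x^*\|^2\Big]=0\qquad\text{for all }(x_0,x_0^*)\in X\times X^*;$$ 5. for all $h\in\mathcal F_T$, $$\inf_{(x,x^*)\in X\times X^*}\Big[h_{(x_0,x_0^*)}(x,x^*)+\tfrac12\|x\|^2+\tfrac12\|x^*\|^2\Big]=0\qquad\text{for all }(x_0,x_0^*)\in X\times X^*.$$ -/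

import Mathlib

namespace FitzpatrickNI

/-- Convexity of an extended-real-valued function: its epigraph is convex. -/
def ConvexE {E : Type*} [AddCommGroup E] [Module ℝ E] (f : E → EReal) : Prop :=
  Convex ℝ {p : E × ℝ | f p.1 ≤ (p.2 : EReal)}

/-- The conjugate `f* : E* → [-∞, ∞]`, `f*(x*) = sup_x ⟨x, x*⟩ - f(x)`. -/
noncomputable def conj {E : Type*} [NormedAddCommGroup E] [NormedSpace ℝ E]
    (f : E → EReal) (x' : StrongDual ℝ E) : EReal :=
  ⨆ x : E, ((x' x : ℝ) : EReal) - f x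

section

variable {X : Type*} [NormedAddCommGroup X] [NormedSpace ℝ X]

/-- A point-to-set operator from `X` to `X*` is a subset of `X × X*`; it is monotone if
`⟨x - y, x* - y*⟩ ≥ 0` for all of its pairs `(x, x*)`, `(y, y*)`. -/
def IsMonotoneOp (T : Set (X × StrongDual ℝ X)) : Prop :=
  ∀ p ∈ T, ∀ q ∈ T, 0 ≤ (p.2 - q.2) (p.1 - q.1)

/-- Maximal, with respect to inclusion, among the monotone operators. -/
def IsMaximalMonotone (T : Set (X × StrongDual ℝ X)) : Prop :=
  Maximal IsMonotoneOp T

/-- The duality product `π` on `X × X*`. With `X*` in place of `X`, it is the duality product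
`π_*` on `X* × X**`. -/
noncomputable def dualityProd (p : X × StrongDual ℝ X) : EReal :=
  ((p.2 p.1 : ℝ) : EReal)

/-- The Fitzpatrick family of `T`. -/
def fitzpatrickFamily (T : Set (X × StrongDual ℝ X)) :
    Set (X × StrongDual ℝ X → EReal) :=
  {h | ConvexE h ∧ LowerSemicontinuous h ∧ (∀ p, dualityProd p ≤ h p) ∧
    ∀ p ∈ T, h p = dualityProd p}

/-- The conjugate of `h : X × X* → [-∞, ∞]` as a function on `X* × X**`, under the identification
of `X* × X**` with the dual of `X × X*`: the pair `(x*, x**)` is the functional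
`(y, y*) ↦ ⟨y, x*⟩ + ⟨y*, x**⟩`. -/
noncomputable def conjPair (h : X × StrongDual ℝ X → EReal)
    (q : StrongDual ℝ X × StrongDual ℝ (StrongDual ℝ X)) : EReal :=
  conj h (q.1.coprod q.2)

/-- The translate `h_{(x₀, x₀*)}`,
`(x, x*) ↦ h(x + x₀, x* + x₀*) - [⟨x, x₀*⟩ + ⟨x₀, x*⟩ + ⟨x₀, x₀*⟩]`. -/
noncomputable def translate (h : X × StrongDual ℝ X → EReal) (p₀ : X × StrongDual ℝ X)
    (p : X × StrongDual ℝ X) : EReal :=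
  h (p + p₀) - ((p₀.2 p.1 + p.2 p₀.1 + p₀.2 p₀.1 : ℝ) : EReal)

/-- A maximal monotone `T` is type NI if `inf_{(y, y*) ∈ T} ⟨y* - x*, y - x**⟩ ≤ 0` for all
`(x*, x**)`, where `y` is identified with its image in `X**`. -/
def IsTypeNI (T : Set (X × StrongDual ℝ X)) : Prop :=
  IsMaximalMonotone T ∧
    ∀ q : StrongDual ℝ X × StrongDual ℝ (StrongDual ℝ X),
      (⨅ p ∈ T, (((NormedSpace.inclusionInDoubleDual ℝ X p.1 - q.2) (p.2 - q.1) : ℝ) : EReal)) ≤ 0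

/-- `h ≥ π` and `h* ≥ π_*`. -/
def MajorizesDualityProds (h : X × StrongDual ℝ X → EReal) : Prop :=
  (∀ p, dualityProd p ≤ h p) ∧
    ∀ q : StrongDual ℝ X × StrongDual ℝ (StrongDual ℝ X), dualityProd q ≤ conjPair h q

/-- For every `(x₀, x₀*)`, the infimum over `(x, x*)` of
`h_{(x₀, x₀*)}(x, x*) + ½‖x‖² + ½‖x*‖²` is `0`. -/
def RegularizedInfZero (h : X × StrongDual ℝ X → EReal) : Prop :=
  ∀ p₀ : X × StrongDual ℝ X,
    (⨅ p : X × StrongDual ℝ X,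
      translate h p₀ p + ((1 / 2 * ‖p.1‖ ^ 2 + 1 / 2 * ‖p.2‖ ^ 2 : ℝ) : EReal)) = 0

end

end FitzpatrickNI

open Filter Topology

namespace FitzpatrickNI

/-! Type NI says that the supremum defining `h*`, taken over `T` alone, already dominates `π_*`; as
`h = π` on `T`, this gives 1 → 3. The Fitzpatrick function shows that the family is nonempty, so
"for all" implies "exists".

From `h* ≥ π_*` to vanishing infima: Young's inequality and `h ≥ π` make the infima nonnegative. A
positive one would put `h` above a continuous concave function; a separating affine function
(`ConvexE.exists_affine_between`) then contradicts `h* ≥ π_*`.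

The return 4 → 1 uses completeness: a Brøndsted–Rockafellar iteration (`exists_near_le_dualityProd`)
moves approximate minimizers onto `{h = π} = T`, so the regularized infima vanish over `T` itself,
and a suitable translate yields NI. -/

section Auxiliary

variable {X : Type*} [NormedAddCommGroup X] [NormedSpace ℝ X]

/-- The Young inequality `f x ≤ ½‖x‖² + ½‖f‖²` is approximately attained. -/
theorem exists_half_sq_norm_sub_le {E : Type*} [NormedAddCommGroup E] [NormedSpace ℝ E]
    (f : StrongDual ℝ E) {δ : ℝ} (hδ : 0 < δ) :
    ∃ x : E, 1 / 2 * ‖f‖ ^ 2 - δ ≤ f x - 1 / 2 * ‖x‖ ^ 2 := by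
  have hf := norm_nonneg f
  obtain ⟨x, hx, hfx⟩ := f.exists_lt_apply_of_lt_opNorm
    (r := ‖f‖ - δ / (‖f‖ + 1)) (by linarith [show 0 < δ / (‖f‖ + 1) by positivity])
  have hδ' : ‖f‖ * (δ / (‖f‖ + 1)) ≤ δ := by
    rw [mul_div_assoc', div_le_iff₀ (by positivity)]
    nlinarith
  have hsq : ‖f‖ ^ 2 * ‖x‖ ^ 2 ≤ ‖f‖ ^ 2 * 1 := by
    gcongr
    exact pow_le_one₀ (norm_nonneg x) hx.le
  have hmul : ‖f‖ * (‖f‖ - δ / (‖f‖ + 1)) ≤ ‖f‖ * |f x| := by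
    gcongr
    exact hfx.le
  rcases abs_cases (f x) with h | h
  · refine ⟨‖f‖ • x, ?_⟩
    rw [map_smul, smul_eq_mul, norm_smul, norm_norm, mul_pow]
    rw [h.1] at hmul
    linarith
  · refine ⟨(-‖f‖) • x, ?_⟩
    rw [map_smul, smul_eq_mul, norm_smul, norm_neg, norm_norm, mul_pow]
    rw [h.1] at hmul
    linarith

theorem neg_half_sq_norm_le_apply {E : Type*} [NormedAddCommGroup E] [NormedSpace ℝ E]
    (f : StrongDual ℝ E) (x : E) : -(1 / 2 * ‖x‖ ^ 2 + 1 / 2 * ‖f‖ ^ 2) ≤ f x := by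
  have h1 := f.le_opNorm x
  have h2 := neg_abs_le (f x)
  rw [Real.norm_eq_abs] at h1
  nlinarith [sq_nonneg (‖f‖ - ‖x‖)]

/-! ### Maximal monotone sets and the Fitzpatrick family. -/

theorem IsMaximalMonotone.mem_of_related {T : Set (X × StrongDual ℝ X)}
    (hT : IsMaximalMonotone T) {p : X × StrongDual ℝ X}
    (hp : ∀ q ∈ T, 0 ≤ (p.2 - q.2) (p.1 - q.1)) : p ∈ T := by
  refine hT.mem_of_prop_insert ?_
  rintro a (rfl | ha) b (rfl | hb)
  · simp
  · exact hp b hb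
  · have := hp a ha
    rw [← neg_sub, ← neg_sub b.1, map_neg, neg_apply, neg_neg]
    exact this
  · exact hT.prop a ha b hb

theorem IsMaximalMonotone.nonempty {T : Set (X × StrongDual ℝ X)}
    (hT : IsMaximalMonotone T) : T.Nonempty := by
  by_contra h
  rw [Set.not_nonempty_iff_eq_empty] at h
  have : (0 : X × StrongDual ℝ X) ∈ T := hT.mem_of_related (by simp [h])
  simp [h] at this

/-- The Fitzpatrick function of `T`. -/
noncomputable def fitzpatrick (T : Set (X × StrongDual ℝ X)) (p : X × StrongDual ℝ X) : EReal :=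
  ⨆ q ∈ T, ((q.2 p.1 + p.2 q.1 - q.2 q.1 : ℝ) : EReal)

theorem convexE_fitzpatrick (T : Set (X × StrongDual ℝ X)) : ConvexE (fitzpatrick T) := by
  intro a ha b hb s t hs ht hst
  simp only [fitzpatrick, Set.mem_ofPred_eq, iSup_le_iff, EReal.coe_le_coe_iff] at ha hb ⊢
  intro q hq
  have h1 := mul_le_mul_of_nonneg_left (ha q hq) hs
  have h2 := mul_le_mul_of_nonneg_left (hb q hq) ht
  simp only [Prod.fst_add, Prod.smul_fst, Prod.snd_add, Prod.smul_snd, map_add, map_smul,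
    add_apply, smul_apply, smul_eq_mul]
  have h3 : (s + t) * q.2 q.1 = q.2 q.1 := by rw [hst, one_mul]
  linarith

theorem lowerSemicontinuous_fitzpatrick (T : Set (X × StrongDual ℝ X)) :
    LowerSemicontinuous (fitzpatrick T) := by
  refine lowerSemicontinuous_biSup fun q _ ↦ Continuous.lowerSemicontinuous ?_
  refine continuous_coe_real_ereal.comp ?_
  fun_prop

/-- A value below `π` at `p` would make `p` monotonically related to `T`, hence a point of `T`,
where the term `q = p` equals `π p`. On `T`, monotonicity gives the upper bound. -/
theorem IsMaximalMonotone.fitzpatrick_mem {T : Set (X × StrongDual ℝ X)}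
    (hT : IsMaximalMonotone T) : fitzpatrick T ∈ fitzpatrickFamily T := by
  have hge : ∀ p, dualityProd p ≤ fitzpatrick T p := by
    intro p
    by_contra! h
    have hq : ∀ q ∈ T, q.2 p.1 + p.2 q.1 - q.2 q.1 < p.2 p.1 := fun q hq ↦ by
      have := (le_iSup₂ (f := fun q (_ : q ∈ T) ↦
        ((q.2 p.1 + p.2 q.1 - q.2 q.1 : ℝ) : EReal)) q hq).trans_lt h
      exact EReal.coe_lt_coe_iff.1 this
    have hp : p ∈ T := hT.mem_of_related fun q hqT ↦ by
      have := hq q hqT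
      simp only [sub_apply, map_sub]
      linarith
    have := hq p hp
    linarith
  refine ⟨convexE_fitzpatrick T, lowerSemicontinuous_fitzpatrick T, hge,
    fun p hp ↦ le_antisymm (iSup₂_le fun q hq ↦ ?_) (hge p)⟩
  have := hT.prop p hp q hq
  simp only [sub_apply, map_sub] at this
  exact EReal.coe_le_coe_iff.2 (by linarith)

theorem ConvexE.half_add_half_le {E : Type*} [AddCommGroup E] [Module ℝ E] {f : E → EReal}
    (hf : ConvexE f) {x y : E} {r s : ℝ} (hx : f x ≤ r) (hy : f y ≤ s) :
    f ((1 / 2 : ℝ) • (x + y)) ≤ ((1 / 2 * (r + s) : ℝ) : EReal) := by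
  have := hf (x := (x, r)) hx (y := (y, s)) hy (a := 1 / 2) (b := 1 / 2)
    (by norm_num) (by norm_num) (by norm_num)
  simpa only [Set.mem_ofPred_eq, Prod.fst_add, Prod.smul_fst, Prod.snd_add, Prod.smul_snd,
    ← smul_add, smul_eq_mul, ← mul_add] using this

/-- A member of the Fitzpatrick family agrees with the duality product only on `T`. -/
theorem IsMaximalMonotone.mem_of_le_dualityProd {T : Set (X × StrongDual ℝ X)}
    (hT : IsMaximalMonotone T) {h : X × StrongDual ℝ X → EReal} (hh : h ∈ fitzpatrickFamily T)
    {p : X × StrongDual ℝ X} (hp : h p ≤ dualityProd p) : p ∈ T := by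
  refine hT.mem_of_related fun q hq ↦ ?_
  -- Comparing `π` with `h` at the midpoint of `p` and `q` leaves `π (p - q) ≥ 0`.
  have h1 := (hh.2.2.1 _).trans (hh.1.half_add_half_le hp (hh.2.2.2 q hq).le)
  have h2 := EReal.coe_le_coe_iff.1 h1
  simp only [Prod.fst_add, Prod.smul_fst, Prod.snd_add, Prod.smul_snd, map_add, map_smul,
    add_apply, smul_apply, smul_eq_mul] at h2
  simp only [sub_apply, map_sub]
  linarith

/-! ### Regularized infima. -/

/-- `h_{p₀}(u) + ½‖u‖² + ½‖u*‖² < η`, written without subtraction in `EReal`. -/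
def RegularizedLT (h : X × StrongDual ℝ X → EReal) (p₀ u : X × StrongDual ℝ X) (η : ℝ) : Prop :=
  h (u + p₀) < ((η - (1 / 2 * ‖u.1‖ ^ 2 + 1 / 2 * ‖u.2‖ ^ 2)
    + (p₀.2 u.1 + u.2 p₀.1 + p₀.2 p₀.1) : ℝ) : EReal)

theorem translate_add_lt_iff {h : X × StrongDual ℝ X → EReal} {p₀ u : X × StrongDual ℝ X}
    {η : ℝ} :
    translate h p₀ u + ((1 / 2 * ‖u.1‖ ^ 2 + 1 / 2 * ‖u.2‖ ^ 2 : ℝ) : EReal) < η ↔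
      RegularizedLT h p₀ u η := by
  unfold translate RegularizedLT
  induction h (u + p₀) with
  | bot =>
    rw [EReal.bot_sub, EReal.bot_add]
    exact iff_of_true (EReal.bot_lt_coe _) (EReal.bot_lt_coe _)
  | top =>
    rw [EReal.top_sub_coe, EReal.top_add_coe]
    exact iff_of_false not_top_lt not_top_lt
  | coe r =>
    rw [← EReal.coe_sub, ← EReal.coe_add, EReal.coe_lt_coe_iff, EReal.coe_lt_coe_iff]
    constructor <;> intro <;> linarith

theorem RegularizedInfZero.exists_regularizedLT {h : X × StrongDual ℝ X → EReal}
    (hh : RegularizedInfZero h) (p₀ : X × StrongDual ℝ X) {η : ℝ} (hη : 0 < η) :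
    ∃ u, RegularizedLT h p₀ u η := by
  have h1 : (⨅ p : X × StrongDual ℝ X, translate h p₀ p +
      ((1 / 2 * ‖p.1‖ ^ 2 + 1 / 2 * ‖p.2‖ ^ 2 : ℝ) : EReal)) < η := by
    rw [hh p₀]
    exact_mod_cast hη
  obtain ⟨u, hu⟩ := iInf_lt_iff.1 h1
  exact ⟨u, translate_add_lt_iff.1 hu⟩

/-- If `h` majorizes the duality product, the regularized infima are nonnegative, so they vanish as
soon as arbitrarily small values are attained. -/
theorem regularizedInfZero_of_exists {h : X × StrongDual ℝ X → EReal}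
    (hπ : ∀ p, dualityProd p ≤ h p)
    (hex : ∀ p₀ : X × StrongDual ℝ X, ∀ η : ℝ, 0 < η → ∃ u, RegularizedLT h p₀ u η) :
    RegularizedInfZero h := by
  intro p₀
  refine le_antisymm (le_of_forall_gt fun c hc ↦ ?_) (le_iInf fun u ↦ ?_)
  · obtain ⟨η, hη, hηc⟩ := EReal.lt_iff_exists_real_btwn.1 hc
    obtain ⟨u, hu⟩ := hex p₀ η (by exact_mod_cast hη)
    exact (iInf_le _ u).trans_lt ((translate_add_lt_iff.2 hu).trans hηc)
  · by_contra! hlt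
    have h1 : RegularizedLT h p₀ u 0 := translate_add_lt_iff.1 (by simpa using hlt)
    have h2 := EReal.coe_lt_coe_iff.1 ((hπ (u + p₀)).trans_lt h1)
    simp only [Prod.fst_add, Prod.snd_add, map_add, add_apply] at h2
    linarith [neg_half_sq_norm_le_apply u.2 u.1]

/-- Approximate minimizers of the regularized translate at `p₀` are bounded in terms of a point
`p₀ + w` at which the translate is at most `M`. -/
theorem RegularizedLT.sq_norm_le {h : X × StrongDual ℝ X → EReal} (hc : ConvexE h)
    (hπ : ∀ p, dualityProd p ≤ h p) {p₀ u w : X × StrongDual ℝ X} {η M : ℝ}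
    (hu : RegularizedLT h p₀ u η)
    (hw : h (w + p₀) ≤ ((M + (p₀.2 w.1 + w.2 p₀.1 + p₀.2 p₀.1) : ℝ) : EReal)) :
    ‖u.1‖ ^ 2 + ‖u.2‖ ^ 2 ≤ 8 * (M + η) + 6 * (‖w.1‖ ^ 2 + ‖w.2‖ ^ 2) := by
  have h1 := EReal.coe_le_coe_iff.1 ((hπ _).trans (hc.half_add_half_le hu.le hw))
  have h2 := neg_half_sq_norm_le_apply (u.2 + w.2) (u.1 + w.1)
  -- The weight of `‖a‖ ^ 2` must be below 2: with weight 2 the `‖u‖ ^ 2` terms would cancel in the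
  -- final estimate.
  have key : ∀ {E : Type _} [NormedAddCommGroup E] (a b : E),
      ‖a + b‖ ^ 2 ≤ 3 / 2 * ‖a‖ ^ 2 + 3 * ‖b‖ ^ 2 := by
    intro E _ a b
    have h3 := norm_add_le a b
    have h4 : ‖a + b‖ ^ 2 ≤ (‖a‖ + ‖b‖) ^ 2 := by gcongr
    nlinarith [sq_nonneg (‖a‖ - 2 * ‖b‖)]
  have h5 := key u.1 w.1
  have h6 := key u.2 w.2
  simp only [Prod.fst_add, Prod.smul_fst, Prod.snd_add, Prod.smul_snd, map_add, map_smul,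
    add_apply, smul_apply, smul_eq_mul] at h1 h2
  linarith

theorem sq_norm_le_prod (u : X × StrongDual ℝ X) : ‖u‖ ^ 2 ≤ ‖u.1‖ ^ 2 + ‖u.2‖ ^ 2 := by
  rw [Prod.norm_def]
  rcases max_cases ‖u.1‖ ‖u.2‖ with h | h <;> rw [h.1] <;>
    nlinarith [sq_nonneg ‖u.1‖, sq_nonneg ‖u.2‖]

/-! ### Brøndsted–Rockafellar iteration. -/

/-- One step of the Brøndsted–Rockafellar iteration. -/
theorem exists_near_of_lt_dualityProd_add {h : X × StrongDual ℝ X → EReal} (hc : ConvexE h)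
    (hπ : ∀ p, dualityProd p ≤ h p) (hreg : RegularizedInfZero h) {p : X × StrongDual ℝ X}
    {ε : ℝ} (hε : 0 < ε) (hp : h p < ((p.2 p.1 + ε ^ 2 : ℝ) : EReal)) {η : ℝ} (hη : 0 < η)
    (hηε : η ≤ ε) :
    ∃ p' : X × StrongDual ℝ X, dist p p' ≤ 4 * ε ∧
      h p' < ((p'.2 p'.1 + η ^ 2 : ℝ) : EReal) := by
  obtain ⟨u, hu⟩ := hreg.exists_regularizedLT p (pow_pos hη 2)
  refine ⟨u + p, ?_, ?_⟩
  -- Comparison with `p` itself gives `‖u‖ ^ 2 ≤ 8 * (ε ^ 2 + η ^ 2) ≤ 16 * ε ^ 2`.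
  · have h1 := hu.sq_norm_le hc hπ (w := 0) (M := ε ^ 2) (by
      simpa [add_comm] using hp.le)
    have h2 := sq_norm_le_prod u
    have h3 : η ^ 2 ≤ ε ^ 2 := by gcongr
    simp only [Prod.fst_zero, Prod.snd_zero, norm_zero] at h1
    rw [dist_comm, dist_eq_norm, add_sub_cancel_right]
    refine abs_le_of_sq_le_sq' (by nlinarith) (by positivity) |>.2
  · refine hu.trans_le (EReal.coe_le_coe_iff.2 ?_)
    simp only [Prod.fst_add, Prod.snd_add, map_add, add_apply]
    linarith [neg_half_sq_norm_le_apply u.2 u.1]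

/-- A Brøndsted–Rockafellar property: approximate solutions of `h = π` are close to solutions. -/
theorem exists_near_le_dualityProd [CompleteSpace X] {h : X × StrongDual ℝ X → EReal}
    (hc : ConvexE h) (hl : LowerSemicontinuous h) (hπ : ∀ p, dualityProd p ≤ h p)
    (hreg : RegularizedInfZero h) {p : X × StrongDual ℝ X}
    {ε : ℝ} (hε : 0 < ε) (hp : h p < ((p.2 p.1 + ε ^ 2 : ℝ) : EReal)) :
    ∃ p' : X × StrongDual ℝ X, dist p p' ≤ 8 * ε ∧ h p' ≤ dualityProd p' := by
  -- Halving the tolerance each time makes the steps `4 * ε / 2 ^ n` sum to `8 * ε`.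
  let S (n : ℕ) := {p : X × StrongDual ℝ X //
    h p < ((p.2 p.1 + (ε / 2 ^ n) ^ 2 : ℝ) : EReal)}
  have step (n : ℕ) (a : S n) : ∃ b : S (n + 1), dist a.1 b.1 ≤ 4 * (ε / 2 ^ n) := by
    obtain ⟨b, hb1, hb2⟩ := exists_near_of_lt_dualityProd_add hc hπ hreg (by positivity) a.2
      (η := ε / 2 ^ (n + 1)) (by positivity) (by gcongr <;> norm_num)
    exact ⟨⟨b, hb2⟩, hb1⟩
  choose next hnext using step
  let a : ∀ n, S n := fun n ↦ Nat.rec ⟨p, by simpa using hp⟩ next n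
  have ha (n : ℕ) : dist (a n).1 (a (n + 1)).1 ≤ 8 * ε / 2 / 2 ^ n := by
    refine (hnext n (a n)).trans_eq (by ring)
  obtain ⟨q, hq⟩ := cauchySeq_tendsto_of_complete (cauchySeq_of_le_geometric_two ha)
  refine ⟨q, dist_le_of_le_geometric_two_of_tendsto₀ ha hq, ?_⟩
  refine le_of_forall_lt fun c hcq ↦ ?_
  by_contra! hle
  obtain ⟨r, hr1, hr2⟩ := EReal.lt_iff_exists_real_btwn.1 (hle.trans_lt hcq)
  have hev : ∀ᶠ n in atTop, r ≤ (a n).1.2 (a n).1.1 + (ε / 2 ^ n) ^ 2 := by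
    filter_upwards [hq.eventually (hl q r hr2)] with n hn
    exact (EReal.coe_lt_coe_iff.1 (hn.trans (a n).2)).le
  have hlim : Tendsto (fun n ↦ (a n).1.2 (a n).1.1 + (ε / 2 ^ n) ^ 2) atTop
      (𝓝 (q.2 q.1 + 0 ^ 2)) := by
    refine Tendsto.add ?_ (Tendsto.pow ?_ 2)
    · have hcont : Continuous fun p : X × StrongDual ℝ X ↦ p.2 p.1 := by fun_prop
      exact (hcont.tendsto q).comp hq
    · exact tendsto_const_nhds.div_atTop (tendsto_pow_atTop_atTop_of_one_lt one_lt_two)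
  have := ge_of_tendsto hlim hev
  exact (EReal.coe_lt_coe_iff.1 hr1).not_ge (by simpa using this)

/-! ### Passage to and from type NI. -/

/-- If the regularized infima of a member of the Fitzpatrick family vanish, then so do those of
the duality product restricted to `T`. -/
theorem exists_mem_regularized_lt [CompleteSpace X] {T : Set (X × StrongDual ℝ X)}
    (hT : IsMaximalMonotone T) {h : X × StrongDual ℝ X → EReal} (hh : h ∈ fitzpatrickFamily T)
    (hreg : RegularizedInfZero h) (p₀ : X × StrongDual ℝ X) {δ : ℝ} (hδ : 0 < δ) :
    ∃ v : X × StrongDual ℝ X, v + p₀ ∈ T ∧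
      v.2 v.1 + (1 / 2 * ‖v.1‖ ^ 2 + 1 / 2 * ‖v.2‖ ^ 2) < δ := by
  -- A fixed point of `T` bounds the approximate minimizers by an `R` independent of `ε`, so `ε` can
  -- be chosen after `R`.
  obtain ⟨q, hq⟩ := hT.nonempty
  set w := q - p₀ with hw
  set M : ℝ := q.2 q.1 - (p₀.2 w.1 + w.2 p₀.1 + p₀.2 p₀.1)
  have hM : h (w + p₀) ≤ ((M + (p₀.2 w.1 + w.2 p₀.1 + p₀.2 p₀.1) : ℝ) : EReal) := by
    rw [hw, sub_add_cancel, hh.2.2.2 q hq, dualityProd]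
    exact EReal.coe_le_coe_iff.2 (by simp only [M]; linarith)
  set R : ℝ := 8 * (M + 1) + 6 * (‖w.1‖ ^ 2 + ‖w.2‖ ^ 2) + 1
  -- uniform estimate on bounded sets
  obtain ⟨ε, hε, hε1, hεδ⟩ : ∃ ε : ℝ, 0 < ε ∧ ε ≤ 1 ∧ ε * (200 + 32 * |R|) < δ := by
    refine ⟨min 1 (δ / (2 * (200 + 32 * |R|))), by positivity, min_le_left _ _, ?_⟩
    calc _ ≤ δ / (2 * (200 + 32 * |R|)) * (200 + 32 * |R|) := by
          gcongr
          exact min_le_right _ _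
      _ = δ / 2 := by field_simp
      _ < δ := by linarith
  obtain ⟨u, hu⟩ := hreg.exists_regularizedLT p₀ (pow_pos hε 2)
  have hε2 : ε ^ 2 ≤ ε := by nlinarith
  have hbd := hu.sq_norm_le hh.1 hh.2.2.1 hM
  have hup : h (u + p₀) < (((u + p₀).2 (u + p₀).1 + ε ^ 2 : ℝ) : EReal) := by
    refine hu.trans_le (EReal.coe_le_coe_iff.2 ?_)
    simp only [Prod.fst_add, Prod.snd_add, map_add, add_apply]
    linarith [neg_half_sq_norm_le_apply u.2 u.1]
  obtain ⟨p', hd, hp'⟩ := exists_near_le_dualityProd hh.1 hh.2.1 hh.2.2.1 hreg hε hup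
  have hmem := hT.mem_of_le_dualityProd hh hp'
  have hπu : u.2 u.1 + (1 / 2 * ‖u.1‖ ^ 2 + 1 / 2 * ‖u.2‖ ^ 2) < ε ^ 2 := by
    have := EReal.coe_lt_coe_iff.1 ((hh.2.2.1 _).trans_lt hu)
    simp only [Prod.fst_add, Prod.snd_add, map_add, add_apply] at this
    linarith
  -- Replacing `u` by `u + d` changes the product and the squared norms by `O(ε * (1 + |R|))`.
  set d := p' - (u + p₀) with hd'
  have hdn : ‖d‖ ≤ 8 * ε := by rwa [hd', ← dist_eq_norm, dist_comm]
  have hd1 : ‖d.1‖ ≤ 8 * ε := (norm_fst_le d).trans hdn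
  have hd2 : ‖d.2‖ ≤ 8 * ε := (norm_snd_le d).trans hdn
  refine ⟨u + d, by rwa [hd', show u + (p' - (u + p₀)) + p₀ = p' by abel], ?_⟩
  have hR : ‖u.1‖ ^ 2 + ‖u.2‖ ^ 2 + 1 ≤ |R| := by
    refine le_trans ?_ (le_abs_self R)
    simp only [R]
    linarith
  have hn1 : ‖u.1 + d.1‖ ^ 2 ≤ (‖u.1‖ + 8 * ε) ^ 2 := by
    gcongr; exact (norm_add_le _ _).trans (by gcongr)
  have hn2 : ‖u.2 + d.2‖ ^ 2 ≤ (‖u.2‖ + 8 * ε) ^ 2 := by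
    gcongr; exact (norm_add_le _ _).trans (by gcongr)
  have apply_le (f : StrongDual ℝ X) (x : X) {a b : ℝ} (hf : ‖f‖ ≤ a) (hx : ‖x‖ ≤ b) :
      f x ≤ a * b :=
    (le_abs_self _).trans ((f.le_opNorm x).trans
      (mul_le_mul hf hx (norm_nonneg _) ((norm_nonneg _).trans hf)))
  have hp1 := apply_le u.2 d.1 le_rfl hd1
  have hp2 := apply_le d.2 u.1 hd2 le_rfl
  have hp3 := apply_le d.2 d.1 hd2 hd1
  have hm1 : ε * (2 * ‖u.1‖) ≤ ε * (‖u.1‖ ^ 2 + 1) := by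
    gcongr; nlinarith [sq_nonneg (‖u.1‖ - 1)]
  have hm2 : ε * (2 * ‖u.2‖) ≤ ε * (‖u.2‖ ^ 2 + 1) := by
    gcongr; nlinarith [sq_nonneg (‖u.2‖ - 1)]
  have hm3 : ε * (‖u.1‖ ^ 2 + ‖u.2‖ ^ 2 + 1) ≤ ε * |R| := by gcongr
  simp only [Prod.fst_add, Prod.snd_add, map_add, add_apply]
  have hεR : 0 ≤ ε * |R| := by positivity
  nlinarith

/-- Translate by `(0, x* + a)`, where `a` nearly attains Young's inequality for `x**`. Young's
inequality for the two cross terms then cancels the squares and leaves an arbitrarily small bound.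
-/
theorem RegularizedInfZero.isTypeNI [CompleteSpace X] {T : Set (X × StrongDual ℝ X)}
    (hT : IsMaximalMonotone T) {h : X × StrongDual ℝ X → EReal} (hh : h ∈ fitzpatrickFamily T)
    (hreg : RegularizedInfZero h) : IsTypeNI T := by
  refine ⟨hT, fun q ↦ le_of_forall_gt fun c hc ↦ ?_⟩
  obtain ⟨η, hη, hηc⟩ := EReal.lt_iff_exists_real_btwn.1 hc
  replace hη : 0 < η := by exact_mod_cast hη
  obtain ⟨a, ha⟩ := exists_half_sq_norm_sub_le q.2 (half_pos hη)
  obtain ⟨v, hv, hvlt⟩ := exists_mem_regularized_lt hT hh hreg (0, q.1 + a) (half_pos hη)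
  refine (iInf₂_le _ hv).trans_lt (lt_trans (EReal.coe_lt_coe_iff.2 ?_) hηc)
  have h1 := neg_half_sq_norm_le_apply q.2 v.2
  have h2 := neg_half_sq_norm_le_apply (-a) v.1
  simp only [Prod.fst_add, Prod.snd_add, add_zero, sub_apply,
    NormedSpace.dual_def, map_sub, map_add, norm_neg, neg_apply] at h1 h2 ⊢
  linarith

/-- For `p ∈ T`, the term of `h*` at `p` is `π_* q` minus the expression in the NI infimum. -/
theorem IsTypeNI.majorizesDualityProds {T : Set (X × StrongDual ℝ X)} (hT : IsTypeNI T)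
    {h : X × StrongDual ℝ X → EReal} (hh : h ∈ fitzpatrickFamily T) :
    MajorizesDualityProds h := by
  refine ⟨hh.2.2.1, fun q ↦ le_of_forall_lt fun c hc ↦ ?_⟩
  obtain ⟨r, hcr, hr⟩ := EReal.lt_iff_exists_real_btwn.1 hc
  replace hr : r < q.2 q.1 := EReal.coe_lt_coe_iff.1 hr
  have hlt := (hT.2 q).trans_lt
    (show (0 : EReal) < ((q.2 q.1 - r : ℝ) : EReal) by exact_mod_cast sub_pos.2 hr)
  obtain ⟨p, hp⟩ := iInf_lt_iff.1 hlt
  obtain ⟨hpT, hp⟩ := iInf_lt_iff.1 hp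
  replace hp := EReal.coe_lt_coe_iff.1 hp
  refine lt_of_lt_of_le ?_ (le_iSup _ p)
  rw [hh.2.2.2 p hpT, dualityProd, ← EReal.coe_sub]
  refine hcr.trans (EReal.coe_lt_coe_iff.2 ?_)
  simp only [sub_apply, NormedSpace.dual_def, map_sub,
    ContinuousLinearMap.coprod_apply] at hp ⊢
  linarith

/-! ### Separation and duality. -/

/-- An extended-real convex function that lies above a continuous concave function is separated
from it by a continuous affine function. -/
theorem ConvexE.exists_affine_between {E : Type*} [NormedAddCommGroup E] [NormedSpace ℝ E]
    {f : E → EReal} (hf : ConvexE f) {g : E → ℝ} (hg : ConcaveOn ℝ Set.univ g)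
    (hgc : Continuous g) (hgf : ∀ x, (g x : EReal) ≤ f x) (hfin : ∃ x, f x ≠ ⊤) :
    ∃ (φ : StrongDual ℝ E) (k : ℝ), (∀ x, g x ≤ φ x + k) ∧
      ∀ x, ((φ x + k : ℝ) : EReal) ≤ f x := by
  have hBc : Convex ℝ {p : E × ℝ | p.2 < g p.1} := by
    simpa using hg.convex_strict_hypograph
  have hBo : IsOpen {p : E × ℝ | p.2 < g p.1} :=
    isOpen_lt continuous_snd (hgc.comp continuous_fst)
  have hdisj : Disjoint {p : E × ℝ | p.2 < g p.1} {p : E × ℝ | f p.1 ≤ (p.2 : EReal)} := by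
    rw [Set.disjoint_left]
    rintro ⟨x, r⟩ h1 h2
    exact (EReal.coe_le_coe_iff.1 ((hgf x).trans h2)).not_gt h1
  obtain ⟨F, u, hB, hA⟩ := geometric_hahn_banach_open hBc hBo hf hdisj
  have hF (x : E) (r : ℝ) : F (x, r) = F (x, 0) + r * F (0, 1) := by
    rw [← smul_eq_mul, ← map_smul, ← map_add]
    simp
  obtain ⟨x₀, hx₀⟩ := hfin
  -- The hyperplane is not vertical, since both sets have points above `x₀`.
  have hc : 0 < F (0, 1) := by
    have hr := EReal.le_coe_toReal hx₀
    have h1 := hA (x₀, (f x₀).toReal) hr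
    have h2 := hB (x₀, g x₀ - 1) (by simp)
    rw [hF] at h1 h2
    have h3 := EReal.coe_le_coe_iff.1 ((hgf x₀).trans hr)
    by_contra! hle
    nlinarith
  set c := F (0, 1)
  refine ⟨-(c⁻¹ • F.comp (ContinuousLinearMap.inl ℝ E ℝ)), c⁻¹ * u, fun x ↦ ?_, fun x ↦ ?_⟩
  · refine le_of_forall_pos_lt_add fun δ hδ ↦ ?_
    have h2 := hB (x, g x - δ) (by simpa using hδ)
    rw [hF, ← lt_sub_iff_add_lt', ← lt_div_iff₀ hc] at h2
    simp only [neg_apply, smul_apply,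
      ContinuousLinearMap.comp_apply, ContinuousLinearMap.inl_apply, smul_eq_mul]
    rw [div_eq_inv_mul] at h2
    linarith
  · refine EReal.le_of_forall_lt_iff_le.1 fun r hr ↦ ?_
    have h1 := hA (x, r) hr.le
    rw [hF, ← sub_le_iff_le_add', ← div_le_iff₀ hc, div_eq_inv_mul] at h1
    refine EReal.coe_le_coe_iff.2 ?_
    simp only [neg_apply, smul_apply,
      ContinuousLinearMap.comp_apply, ContinuousLinearMap.inl_apply, smul_eq_mul]
    linarith

theorem convexOn_half_sq_norm (E : Type*) [NormedAddCommGroup E] [NormedSpace ℝ E] :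
    ConvexOn ℝ Set.univ fun x : E ↦ 1 / 2 * ‖x‖ ^ 2 := by
  have h := (convexOn_univ_norm (E := E)).pow (fun _ _ ↦ norm_nonneg _) 2
  exact h.smul (c := (1 / 2 : ℝ)) (by norm_num)

/-- If no value is below `η`, some affine `φ + k` separates `h` from the concave `g`. With `φ = q`,
the upper bound gives `π_* q ≤ h* q ≤ -k`, while maximizing `g - φ` gives `k` a lower bound; Young's
inequality for `p₀ - q` makes the two incompatible. -/
theorem MajorizesDualityProds.regularizedInfZero {h : X × StrongDual ℝ X → EReal}
    (hc : ConvexE h) (hfin : ∃ p, h p ≠ ⊤) (hm : MajorizesDualityProds h) :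
    RegularizedInfZero h := by
  refine regularizedInfZero_of_exists hm.1 fun p₀ η hη ↦ ?_
  by_contra! hno
  let L : StrongDual ℝ (X × StrongDual ℝ X) :=
    p₀.2.coprod (NormedSpace.inclusionInDoubleDual ℝ X p₀.1)
  let N : X × StrongDual ℝ X → ℝ := fun u ↦ 1 / 2 * ‖u.1‖ ^ 2 + 1 / 2 * ‖u.2‖ ^ 2
  have hN : ConvexOn ℝ Set.univ N :=
    ((convexOn_half_sq_norm X).comp_linearMap (LinearMap.fst ℝ X (StrongDual ℝ X))).add
      ((convexOn_half_sq_norm (StrongDual ℝ X)).comp_linearMap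
        (LinearMap.snd ℝ X (StrongDual ℝ X)))
  let g : X × StrongDual ℝ X → ℝ := fun p ↦ (η - p₀.2 p₀.1) + (L p - N (p - p₀))
  have hN' : ConvexOn ℝ Set.univ fun p ↦ N (p - p₀) := by
    have := hN.translate_left (-p₀)
    simpa [Function.comp_def, sub_eq_add_neg] using this
  have hg : ConcaveOn ℝ Set.univ g :=
    (concaveOn_const _ convex_univ).add ((L.toLinearMap.concaveOn convex_univ).sub hN')
  have hgc : Continuous g := by fun_prop
  have hL (p : X × StrongDual ℝ X) : L p = p₀.2 p.1 + p.2 p₀.1 := by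
    simp [L]
  have hgh (p : X × StrongDual ℝ X) : (g p : EReal) ≤ h p := by
    have := hno (p - p₀)
    rw [RegularizedLT, not_lt, sub_add_cancel] at this
    refine (EReal.coe_le_coe_iff.2 (le_of_eq ?_)).trans this
    simp only [g, N, hL, Prod.fst_sub, Prod.snd_sub, map_sub, sub_apply]
    ring
  obtain ⟨φ, k, hφg, hφh⟩ := hc.exists_affine_between hg hgc hgh hfin
  let q : StrongDual ℝ X × StrongDual ℝ (StrongDual ℝ X) :=
    (φ.comp (ContinuousLinearMap.inl ℝ X (StrongDual ℝ X)),
      φ.comp (ContinuousLinearMap.inr ℝ X (StrongDual ℝ X)))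
  have hq (p : X × StrongDual ℝ X) : φ p = q.1 p.1 + q.2 p.2 := by
    simp [q, ← map_add]
  have hconj : q.2 q.1 ≤ -k := by
    have : conjPair h q ≤ ((-k : ℝ) : EReal) := iSup_le fun p ↦ by
      refine EReal.sub_le_of_le_add' ?_
      refine le_trans ?_ (add_le_add_left (hφh p) _)
      rw [← EReal.coe_add, EReal.coe_le_coe_iff, hq, ContinuousLinearMap.coprod_apply]
      linarith
    exact EReal.coe_le_coe_iff.1 ((hm.2 q).trans this)
  -- Two losses of `η / 4` still leave a gap of `η / 2`.
  obtain ⟨x, hx⟩ := exists_half_sq_norm_sub_le (p₀.2 - q.1) (δ := η / 4) (by positivity)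
  obtain ⟨y, hy⟩ := exists_half_sq_norm_sub_le
    (NormedSpace.inclusionInDoubleDual ℝ X p₀.1 - q.2) (δ := η / 4) (by positivity)
  have h1 := hφg ((x, y) + p₀)
  have h2 := neg_half_sq_norm_le_apply
    (NormedSpace.inclusionInDoubleDual ℝ X p₀.1 - q.2) (p₀.2 - q.1)
  simp only [g, N, add_sub_cancel_right, hL, hq, Prod.fst_add, Prod.snd_add, map_add, map_sub,
    add_apply, sub_apply, NormedSpace.dual_def]
    at h1 h2 hx hy
  linarith

end Auxiliary

end FitzpatrickNI

theorem mainTheorem4 {X : Type*} [NormedAddCommGroup X] [NormedSpace ℝ X] [CompleteSpace X]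
    (T : Set (X × StrongDual ℝ X)) (hT : FitzpatrickNI.IsMaximalMonotone T) :
    List.TFAE [
      FitzpatrickNI.IsTypeNI T,
      ∃ h ∈ FitzpatrickNI.fitzpatrickFamily T, FitzpatrickNI.MajorizesDualityProds h,
      ∀ h ∈ FitzpatrickNI.fitzpatrickFamily T, FitzpatrickNI.MajorizesDualityProds h,
      ∃ h ∈ FitzpatrickNI.fitzpatrickFamily T, FitzpatrickNI.RegularizedInfZero h,
      ∀ h ∈ FitzpatrickNI.fitzpatrickFamily T, FitzpatrickNI.RegularizedInfZero h] := by
  have hfin : ∀ h ∈ FitzpatrickNI.fitzpatrickFamily T, ∃ p, h p ≠ ⊤ := fun h hh ↦ by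
    obtain ⟨p, hp⟩ := hT.nonempty
    exact ⟨p, by rw [hh.2.2.2 p hp]; exact EReal.coe_ne_top _⟩
  tfae_have 1 → 3 := fun hNI _ hh ↦ hNI.majorizesDualityProds hh
  tfae_have 3 → 2 := fun H ↦ ⟨_, hT.fitzpatrick_mem, H _ hT.fitzpatrick_mem⟩
  tfae_have 2 → 4 := fun ⟨h, hh, hm⟩ ↦ ⟨h, hh, hm.regularizedInfZero hh.1 (hfin h hh)⟩
  tfae_have 3 → 5 := fun H h hh ↦ (H h hh).regularizedInfZero hh.1 (hfin h hh)
  tfae_have 5 → 4 := fun H ↦ ⟨_, hT.fitzpatrick_mem, H _ hT.fitzpatrick_mem⟩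
  tfae_have 4 → 1 := fun ⟨_, hh, hreg⟩ ↦ hreg.isTypeNI hT hh
  tfae_finish
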